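/- Let $d\in\mathbb{N}$, let $A$ be a real $d\times d$ matrix all of whose (complex) eigenvalues have negative real parts, let $F:[0,\infty)\to\mathbb{R}^d$ be continuous with components $F_1,\dots,F_d$, let $\zeta\in\mathbb{R}^d$, and let $\gamma:[0,\infty)\to(0,\infty)$ be continuous and non-decreasing. Let $\|\cdot\|$ be any norm on $\mathbb{R}^d$, and write $a^+=\max(a,0)$. Let $x$ be the unique continuous solution of $x'(t)=Ax(t)+F(t)$, $t\ge 0$, $x(0)=\zeta$, and let $y$ be the unique continuous solution of $y'(t)=-y(t)+F(t)$, $t\ge0$, $y(0)=0$. Then the following are equivalent (limits superior are taken in $[-\infty,\infty]$): (A) There exist $\Delta>0$ and $K>0$ such that $$\Big\|\int_{(t-\theta)^+}^t F(s)\,ds\Big\|\le K\gamma(t),\qquad \theta\in[0,\Delta],\ t\ge 0,$$ and there exist $i\in\{1,\dots,d\}$ and $\theta'>0$ such that $$\limsup_{t\to\infty}\frac{\big|\int_{t-\theta'}^t F_i(s)\,ds\big|}{\gamma(t)}>0.$$ (A$'$) For every $\Delta>0$ there is $K=K(\Delta)>0$ such that $\big\|\int_{(t-\theta)^+}^t F(s)\,ds\big\|\le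 K\gamma(t)$ for all $\theta\in[0,\Delta]$ and $t\ge 0$, and there exist $i\in\{1,\dots,d\}$ and $\theta'\in(0,\Delta]$ such that $$\limsup_{t\to\infty}\frac{\big|\int_{t-\theta'}^t F_i(s)\,ds\big|}{\gamma(t)}>0.$$ (A$''$) For every $\Delta>0$ there is $K=K(\Delta)>0$ such that $\big\|\int_{(t-\theta)^+}^t F(s)\,ds\big\|\le K\gamma(t)$ for all $\theta\in[0,\Delta]$ and $t\ge 0$, and there exists $i\in\{1,\dots,d\}$ such that $$\mathrm{Leb}\left(\Big\{\theta\in[0,\Delta]:\ \limsup_{t\to\infty}\frac{\big|\int_{t-\theta}^t F_i(s)\,ds\big|}{\gamma(t)}=0\Big\}\right)=0.$$ (B) $\displaystyle\limsup_{t\to\infty}\frac{\|y(t)\|}{\gamma(t)}\in(0,\infty)$. (C) $\displaystyle\limsup_{t\to\infty}\frac{\|x(t)\|}{\gamma(t)}\in(0,\infty)$. -/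

import Mathlib

open Set Filter MeasureTheory

/-- All (complex) eigenvalues of the real square matrix `A` have negative real parts. -/
def IsHurwitz {d : ℕ} (A : Matrix (Fin d) (Fin d) ℝ) : Prop :=
  ∀ μ : ℂ, Module.End.HasEigenvalue (Matrix.toLin' (A.map (algebraMap ℝ ℂ))) μ → μ.re < 0

/-- `u` solves `u'(t) = A u(t) + F(t)` for `t ≥ 0` (one-sided derivative at `0`), `u(0) = ξ`.
Only the values of `u` and `F` on `[0, ∞)` matter. -/
def IsForcedSolution {d : ℕ} (A : Matrix (Fin d) (Fin d) ℝ) (F : ℝ → Fin d → ℝ)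
    (ξ : Fin d → ℝ) (u : ℝ → Fin d → ℝ) : Prop :=
  u 0 = ξ ∧ ∀ t : ℝ, 0 ≤ t → HasDerivWithinAt u (A.mulVec (u t) + F t) (Ici 0) t

/-- The limit superior of `g(t) / γ(t)` as `t → ∞`, as an extended real number. -/
noncomputable def limsupRatio (g γ : ℝ → ℝ) : EReal :=
  limsup (fun t : ℝ => ((g t / γ t : ℝ) : EReal)) atTop

/-- `‖∫_{(t-θ)⁺}^t F(s) ds‖ ≤ K γ(t)` for all `θ ∈ [0, Δ]` and `t ≥ 0`, with `‖·‖ = N`. -/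
def LagIntegralBound {d : ℕ} (N : Seminorm ℝ (Fin d → ℝ)) (F : ℝ → Fin d → ℝ) (γ : ℝ → ℝ)
    (Δ K : ℝ) : Prop :=
  ∀ θ ∈ Icc (0 : ℝ) Δ, ∀ t : ℝ, 0 ≤ t → N (∫ s in (max (t - θ) 0)..t, F s) ≤ K * γ t

/-- The limit superior of `|∫_{t-θ}^t f(s) ds| / γ(t)` as `t → ∞`, as an extended real number
(only `t ≥ θ` matters). -/
noncomputable def lagLimsup (f γ : ℝ → ℝ) (θ : ℝ) : EReal :=
  limsupRatio (fun t : ℝ => |∫ s in (t - θ)..t, f s|) γ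

open Asymptotics Topology

/-! Being `O(γ)` or `o(γ)` passes from the forcing of a stable linear system to its solution,
because `γ` is non-decreasing and the homogeneous flow decays exponentially. `Dominated o` carries
both orders at once: `o := False` leaves only `O`, `o := True` amounts to `o(γ)`.

(B) ↔ (C): the difference of two solutions with different matrices no longer contains `F`; it is
forced by a linear image of one of them (`Dominated.forced_of_forced`).

Lags ↔ `y`: let `J` be the primitive of `F`. Since `(J - y)' = y`, increments of `J` are controlled
by `y`. Conversely, the average `v` of `J t - J (t - u)` over `u ∈ [0, 1]` satisfies `v' = F - (J t
- J (t - 1))`, so `y - v` solves a stable equation forced by lags alone (`dominated_of_lags`).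

Among lags: negligible lags are closed under sums and ordered differences, so by Steinhaus a
non-null set of them makes every lag negligible (`IsNegligibleLag.of_volume_ne_zero`). -/

/-- `h` is `O(γ)` at infinity, and moreover `o(γ)` if `o` holds. -/
def Dominated {V : Type*} [NormedAddCommGroup V] (o : Prop) (h : ℝ → V) (γ : ℝ → ℝ) : Prop :=
  h =O[atTop] γ ∧ (o → h =o[atTop] γ)

/-- `γ` is positive and non-decreasing on `[0, ∞)`. -/
structure IsRate (γ : ℝ → ℝ) : Prop where
  mono : MonotoneOn γ (Ici 0)
  pos : ∀ t : ℝ, 0 ≤ t → 0 < γ t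

/-! ### Calculus of growth bounds -/

section Dominated

variable {V W : Type*} [NormedAddCommGroup V] [NormedAddCommGroup W] {o : Prop} {γ : ℝ → ℝ}

theorem Dominated.add {g h : ℝ → V} (hg : Dominated o g γ) (hh : Dominated o h γ) :
    Dominated o (fun t => g t + h t) γ :=
  ⟨hg.1.add hh.1, fun ho => (hg.2 ho).add (hh.2 ho)⟩

theorem Dominated.neg {g : ℝ → V} (hg : Dominated o g γ) : Dominated o (fun t => -g t) γ :=
  ⟨hg.1.neg_left, fun ho => (hg.2 ho).neg_left⟩

theorem Dominated.clm [NormedSpace ℝ V] [NormedSpace ℝ W] {g : ℝ → V} (hg : Dominated o g γ) (B : V →L[ℝ] W) :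
    Dominated o (fun t => B (g t)) γ :=
  ⟨(B.isBigO_comp g _).trans hg.1, fun ho => (B.isBigO_comp g _).trans_isLittleO (hg.2 ho)⟩

theorem Dominated.of_norm_le {g : ℝ → V} {h : ℝ → W} (hg : Dominated o g γ)
    (h_le : ∀ t, ‖h t‖ ≤ ‖g t‖) : Dominated o h γ :=
  ⟨(IsBigO.of_norm_le h_le).trans hg.1.norm_left,
    fun ho => (IsBigO.of_norm_le h_le).trans_isLittleO (hg.2 ho).norm_left⟩

theorem Dominated.congr {g h : ℝ → V} (hg : Dominated o g γ)
    (hgh : ∀ t, 0 ≤ t → g t = h t) : Dominated o h γ := by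
  have e : g =ᶠ[atTop] h := (eventually_ge_atTop 0).mono hgh
  exact ⟨hg.1.congr' e .rfl, fun ho => (hg.2 ho).congr' e .rfl⟩

theorem IsRate.norm_eq (hγ : IsRate γ) {t : ℝ} (ht : 0 ≤ t) : ‖γ t‖ = γ t :=
  Real.norm_of_nonneg (hγ.pos t ht).le

theorem IsRate.isBigO_iff (hγ : IsRate γ) {h : ℝ → V} :
    h =O[atTop] γ ↔ ∃ c > 0, ∀ᶠ t in atTop, ‖h t‖ ≤ c * γ t := by
  rw [isBigO_iff']
  refine exists_congr fun c => and_congr_right fun _ => ?_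
  refine eventually_congr ((eventually_ge_atTop 0).mono fun t ht => ?_)
  rw [hγ.norm_eq ht]

theorem IsRate.isLittleO_iff (hγ : IsRate γ) {h : ℝ → V} :
    h =o[atTop] γ ↔ ∀ c > 0, ∀ᶠ t in atTop, ‖h t‖ ≤ c * γ t := by
  rw [Asymptotics.isLittleO_iff]
  refine forall_congr' fun c => imp_congr_right fun _ => ?_
  refine eventually_congr ((eventually_ge_atTop 0).mono fun t ht => ?_)
  rw [hγ.norm_eq ht]

end Dominated

/-! ### Stable linear equations over ℂ -/

section Scalar

variable {V : Type*} [NormedAddCommGroup V] [NormedSpace ℂ V] {γ : ℝ → ℝ}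

/-- The integrating factor `exp (-μ (t - t₀))` removes the linear term; the remaining derivative is
bounded by `M` times a real exponential, which integrates explicitly. -/
theorem norm_le_of_scalar_ode {μ : ℂ} (hμ : μ.re < 0) {w h : ℝ → V} {t₀ T M : ℝ} (hT : t₀ ≤ T)
    (hw : ∀ t ∈ Icc t₀ T, HasDerivWithinAt w (μ • w t + h t) (Ici t₀) t)
    (hh : ∀ t ∈ Icc t₀ T, ‖h t‖ ≤ M) :
    ‖w T‖ ≤ ‖w t₀‖ * Real.exp (μ.re * (T - t₀)) + M / (-μ.re) := by
  have hM : 0 ≤ M := (norm_nonneg _).trans (hh T ⟨hT, le_rfl⟩)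
  let e : ℝ → ℂ := fun t => Complex.exp (-μ * ((t - t₀ : ℝ) : ℂ))
  have he : ∀ t, HasDerivAt e (e t * (-μ)) t := fun t => by
    have h1 : HasDerivAt (fun t : ℝ => ((t - t₀ : ℝ) : ℂ)) 1 t := by
      simpa using ((hasDerivAt_id t).sub_const t₀).ofReal_comp
    simpa only [mul_one] using (h1.const_mul (-μ)).cexp
  have hne : ∀ t, ‖e t‖ = Real.exp (-μ.re * (t - t₀)) := fun t => by
    simp [e, Complex.norm_exp]
  have hd : ∀ t ∈ Icc t₀ T, HasDerivWithinAt (fun t => e t • w t) (e t • h t) (Ici t₀) t := by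
    intro t ht
    have := (he t).hasDerivWithinAt.smul (hw t ht)
    refine this.congr_deriv ?_
    rw [smul_add, smul_smul, mul_neg, neg_smul]
    abel
  have key := image_norm_le_of_norm_deriv_right_le_deriv_boundary (a := t₀) (b := T)
    (f := fun t => e t • w t) (f' := fun t => e t • h t)
    (B := fun t => ‖w t₀‖ + M / (-μ.re) * (Real.exp (-μ.re * (t - t₀)) - 1))
    (B' := fun t => M * Real.exp (-μ.re * (t - t₀)))
    (fun t ht => (hd t ht).continuousWithinAt.mono Icc_subset_Ici_self)
    (fun t ht => (hd t ⟨ht.1, ht.2.le⟩).mono (Ici_subset_Ici.2 ht.1))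
    (by simp [e])
    (fun t => by
      have h1 : HasDerivAt (fun t : ℝ => -μ.re * (t - t₀)) (-μ.re) t := by
        simpa using ((hasDerivAt_id t).sub_const t₀).const_mul (-μ.re)
      refine (((h1.exp.sub_const 1).const_mul (M / (-μ.re))).const_add ‖w t₀‖).congr_deriv ?_
      have := hμ.ne
      field_simp)
    (fun t ht => by
      rw [norm_smul, hne, mul_comm]
      exact mul_le_mul_of_nonneg_right (hh t ⟨ht.1, ht.2.le⟩) (Real.exp_pos _).le)
    (right_mem_Icc.2 hT)
  simp only [norm_smul, hne] at key
  have hE : Real.exp (-μ.re * (T - t₀)) * Real.exp (μ.re * (T - t₀)) = 1 := by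
    rw [← Real.exp_add]; simp
  have hpos := Real.exp_pos (μ.re * (T - t₀))
  have hq : 0 ≤ M / (-μ.re) := div_nonneg hM (by linarith)
  have := mul_le_mul_of_nonneg_right key hpos.le
  calc ‖w T‖ = Real.exp (-μ.re * (T - t₀)) * ‖w T‖ * Real.exp (μ.re * (T - t₀)) := by
        rw [mul_right_comm, hE, one_mul]
    _ ≤ _ := this
    _ = ‖w t₀‖ * Real.exp (μ.re * (T - t₀)) + M / (-μ.re) * (1 - Real.exp (μ.re * (T - t₀))) := by
        linear_combination (M / (-μ.re)) * hE
    _ ≤ _ := by nlinarith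

/-- On `[t₀, T]` the forcing is at most `c * γ T` by monotonicity, and the decaying initial term is
eventually below `c * γ 0`. The constant is linear in `c`, so it serves both `O` and `o`. -/
theorem eventually_norm_le_of_scalar_ode (hγ : IsRate γ) {μ : ℂ} (hμ : μ.re < 0) {w h : ℝ → V}
    (hw : ∀ t, 0 ≤ t → HasDerivWithinAt w (μ • w t + h t) (Ici 0) t) {c : ℝ} (hc : 0 < c)
    (hh : ∀ᶠ t in atTop, ‖h t‖ ≤ c * γ t) :
    ∀ᶠ t in atTop, ‖w t‖ ≤ c * (1 + 1 / (-μ.re)) * γ t := by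
  obtain ⟨t₀, ht₀, hb⟩ := ((eventually_ge_atTop (0 : ℝ)).and (eventually_forall_ge_atTop.2 hh)).exists
  have hlim : Tendsto (fun T : ℝ => ‖w t₀‖ * Real.exp (μ.re * (T - t₀))) atTop (𝓝 0) := by
    have : Tendsto (fun T : ℝ => μ.re * (T - t₀)) atTop atBot :=
      (tendsto_atTop_add_const_right _ _ tendsto_id).const_mul_atTop_of_neg hμ
    simpa using (Real.tendsto_exp_atBot.comp this).const_mul ‖w t₀‖
  filter_upwards [eventually_ge_atTop t₀,
    hlim.eventually (gt_mem_nhds (mul_pos hc (hγ.pos 0 le_rfl)))] with T hT hsmall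
  have hT0 : 0 ≤ T := ht₀.trans hT
  have h1 := norm_le_of_scalar_ode hμ (M := c * γ T) hT
    (fun t ht => (hw t (ht₀.trans ht.1)).mono (Ici_subset_Ici.2 ht₀))
    (fun t ht => (hb t ht.1).trans <| mul_le_mul_of_nonneg_left
      (hγ.mono (ht₀.trans ht.1) hT0 ht.2) hc.le)
  have h2 : c * γ 0 ≤ c * γ T := mul_le_mul_of_nonneg_left (hγ.mono self_mem_Ici hT0 hT0) hc.le
  calc ‖w T‖ ≤ c * γ T + c * γ T / (-μ.re) := by linarith
    _ = _ := by ring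

theorem Dominated.of_scalar_ode {o : Prop} (hγ : IsRate γ) {μ : ℂ} (hμ : μ.re < 0) {w h : ℝ → V}
    (hw : ∀ t, 0 ≤ t → HasDerivWithinAt w (μ • w t + h t) (Ici 0) t)
    (hh : Dominated o h γ) : Dominated o w γ := by
  have hk : 0 < 1 + 1 / (-μ.re) := by
    have := one_div_pos.2 (neg_pos.2 hμ)
    linarith
  refine ⟨?_, fun ho => ?_⟩
  · obtain ⟨c, hc, hb⟩ := hγ.isBigO_iff.1 hh.1
    exact hγ.isBigO_iff.2 ⟨_, mul_pos hc hk, eventually_norm_le_of_scalar_ode hγ hμ hw hc hb⟩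
  · refine hγ.isLittleO_iff.2 fun c hc => ?_
    have := eventually_norm_le_of_scalar_ode hγ hμ hw (div_pos hc hk)
      (hγ.isLittleO_iff.1 (hh.2 ho) _ (div_pos hc hk))
    rwa [div_mul_cancel₀ _ hk.ne'] at this

open Polynomial in
/-- A solution of `u' = B u + g` annihilated by a polynomial in `B` with stable roots is dominated
by whatever dominates `g`. -/
theorem Dominated.of_linear_ode [FiniteDimensional ℂ V] {o : Prop} (hγ : IsRate γ)
    (B : Module.End ℂ V) (l : List ℂ) (hl : ∀ μ ∈ l, μ.re < 0) : ∀ {u g : ℝ → V},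
    (∀ t, 0 ≤ t → HasDerivWithinAt u (B (u t) + g t) (Ici 0) t) → Dominated o g γ →
    (∀ t, 0 ≤ t → aeval B (l.map fun μ => X - C μ).prod (u t) = 0) → Dominated o u γ := by
  induction l with
  | nil =>
    intro u g _ _ h0
    refine Dominated.congr (g := fun _ => 0)
      ⟨isBigO_zero _ _, fun _ => isLittleO_zero _ _⟩ fun t ht => ?_
    simpa using (h0 t ht).symm
  | cons μ l ih =>
    intro u g hu hg h0
    -- Peel off one factor: `D u` solves the same equation with forcing `D g` and is killed by the
    -- shorter product. Then `B u = μ • u + D u` reduces `u` to a scalar equation.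
    let D : Module.End ℂ V := B - algebraMap ℂ _ μ
    let Dc : V →L[ℝ] V := (LinearMap.toContinuousLinearMap D).restrictScalars ℝ
    have hD : ∀ v, Dc v = B v - μ • v := fun v => by simp [Dc, D]
    have hcomm : ∀ v, Dc (B v) = B (Dc v) := fun v => by simp [hD]
    have hw : Dominated o (fun t => Dc (u t)) γ := by
      refine ih (fun ν hν => hl ν (List.mem_cons_of_mem _ hν)) (g := fun t => Dc (g t))
        (fun t ht => ?_) (hg.clm Dc) (fun t ht => ?_)
      · have := Dc.hasFDerivAt.comp_hasDerivWithinAt t (hu t ht)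
        refine this.congr_deriv ?_
        rw [map_add, hcomm]
      · have := h0 t ht
        rw [List.map_cons, List.prod_cons, mul_comm, map_mul, Module.End.mul_apply] at this
        rw [← this, hD]
        simp
    refine Dominated.of_scalar_ode hγ (hl μ List.mem_cons_self) (fun t ht => ?_) (hw.add hg)
    refine (hu t ht).congr_deriv ?_
    rw [hD]
    abel

end Scalar

/-! ### Hurwitz matrices -/

section Real

variable {d : ℕ} {γ : ℝ → ℝ} {o : Prop}

theorem Dominated.of_hurwitz (hγ : IsRate γ) {A : Matrix (Fin d) (Fin d) ℝ} (hA : IsHurwitz A)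
    {u g : ℝ → Fin d → ℝ}
    (hu : ∀ t : ℝ, 0 ≤ t → HasDerivWithinAt u (A.mulVec (u t) + g t) (Ici 0) t)
    (hg : Dominated o g γ) : Dominated o u γ := by
  let B : Module.End ℂ (Fin d → ℂ) := Matrix.toLin' (A.map (algebraMap ℝ ℂ))
  let ι : (Fin d → ℝ) →L[ℝ] (Fin d → ℂ) :=
    ContinuousLinearMap.pi fun i => Complex.ofRealCLM.comp (ContinuousLinearMap.proj i)
  have hι : ∀ v i, ι v i = (v i : ℂ) := fun v i => rfl
  have hιn : ∀ v, ‖ι v‖ = ‖v‖ := fun v => by simp [Pi.norm_def, hι]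
  -- Over ℂ the characteristic polynomial splits, and Cayley–Hamilton provides the annihilating
  -- product.
  have hp := (IsAlgClosed.splits B.charpoly).eq_prod_roots_of_monic B.charpoly_monic
  have h0 : Polynomial.aeval B (B.charpoly.roots.toList.map
      fun μ => Polynomial.X - Polynomial.C μ).prod = 0 := by
    rw [← Multiset.prod_coe, ← Multiset.map_coe, Multiset.coe_toList, ← hp]
    exact B.aeval_self_charpoly
  have hroots : ∀ μ ∈ B.charpoly.roots.toList, μ.re < 0 := fun μ hμ =>
    hA μ ((Module.End.hasEigenvalue_iff_isRoot_charpoly _ _).2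
      (Polynomial.isRoot_of_mem_roots (Multiset.mem_toList.1 hμ)))
  have := Dominated.of_linear_ode hγ B _ hroots (u := fun t => ι (u t)) (g := fun t => ι (g t))
    (fun t ht => ?_) (hg.clm ι) (fun t _ => by rw [h0]; rfl)
  · exact this.of_norm_le fun t => (hιn _).ge
  · refine (ι.hasFDerivAt.comp_hasDerivWithinAt t (hu t ht)).congr_deriv ?_
    rw [map_add]
    congr 1
    ext i
    simp [B, hι, Matrix.mulVec, dotProduct]

theorem isHurwitz_neg_one : IsHurwitz (-1 : Matrix (Fin d) (Fin d) ℝ) := by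
  intro μ hμ
  obtain ⟨v, hv⟩ := hμ.exists_hasEigenvector
  have h1 := hv.apply_eq_smul
  have h2 : ((-1 : Matrix (Fin d) (Fin d) ℝ).map (algebraMap ℝ ℂ)) = -1 := by
    ext i j
    by_cases h : i = j <;> simp [h]
  rw [h2, Matrix.toLin'_apply, Matrix.neg_mulVec, Matrix.one_mulVec] at h1
  have h3 : (μ + 1) • v = 0 := by rw [add_smul, ← h1]; simp
  have h4 : μ + 1 = 0 := (smul_eq_zero.1 h3).resolve_right hv.2
  rw [eq_neg_of_add_eq_zero_left h4]
  simp

theorem Dominated.forced_of_forced (hγ : IsRate γ) {A B : Matrix (Fin d) (Fin d) ℝ}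
    (hB : IsHurwitz B) {F x y : ℝ → Fin d → ℝ} {ξ η : Fin d → ℝ} (hx : IsForcedSolution A F ξ x)
    (hy : IsForcedSolution B F η y) (h : Dominated o x γ) : Dominated o y γ := by
  let D : (Fin d → ℝ) →L[ℝ] (Fin d → ℝ) :=
    LinearMap.toContinuousLinearMap (Matrix.toLin' (B - A))
  have hD : ∀ v, D v = B.mulVec v - A.mulVec v := fun v => by
    simp [D]
  have key : Dominated o (fun t => y t - x t) γ := by
    refine Dominated.of_hurwitz hγ hB (g := fun t => D (x t)) (fun t ht => ?_) (h.clm D)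
    refine ((hy.2 t ht).sub (hx.2 t ht)).congr_deriv ?_
    rw [hD, Matrix.mulVec_sub]
    abel
  simpa using key.add h

end Real

/-! ### Equivalence of norms -/

section Seminorm

theorem Seminorm.exists_le_mul_norm {ι : Type*} [Fintype ι] (N : Seminorm ℝ (ι → ℝ)) :
    ∃ C > 0, ∀ v, N v ≤ C * ‖v‖ := by
  classical
  refine ⟨∑ i, N (Pi.single i 1) + 1, by positivity, fun v => ?_⟩
  have hv : v = ∑ i, v i • (Pi.single i (1 : ℝ) : ι → ℝ) := by
    ext j
    simp [Finset.sum_apply, Pi.single_apply]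
  calc N v = N (∑ i, v i • (Pi.single i (1 : ℝ) : ι → ℝ)) := by rw [← hv]
    _ ≤ ∑ i, N (v i • (Pi.single i (1 : ℝ) : ι → ℝ)) :=
        Finset.le_sum_of_subadditive N (map_zero N).le (map_add_le_add N) _ _
    _ ≤ ∑ i, N (Pi.single i 1) * ‖v‖ := by
        refine Finset.sum_le_sum fun i _ => ?_
        rw [map_smul_eq_mul, mul_comm]
        exact mul_le_mul_of_nonneg_left (norm_le_pi_norm v i) (apply_nonneg N _)
    _ ≤ _ := by
        rw [← Finset.sum_mul]
        nlinarith [norm_nonneg v]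

theorem Seminorm.exists_norm_le_mul {ι : Type*} [Fintype ι] (N : Seminorm ℝ (ι → ℝ))
    (hN : ∀ v, N v = 0 → v = 0) : ∃ C > 0, ∀ v, ‖v‖ ≤ C * N v := by
  obtain ⟨C, hC, hle⟩ := N.exists_le_mul_norm
  have hcont : Continuous N := by
    refine (LipschitzWith.of_dist_le_mul (K := C.toNNReal) fun v w => ?_).continuous
    rw [Real.dist_eq, dist_eq_norm, Real.coe_toNNReal _ hC.le]
    exact (abs_sub_map_le_sub N v w).trans (hle _)
  -- The unit sphere is empty exactly when the space is trivial.
  rcases (Metric.sphere (0 : ι → ℝ) 1).eq_empty_or_nonempty with he | hne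
  · refine ⟨1, one_pos, fun v => ?_⟩
    by_cases hv : v = 0
    · simp [hv]
    · have : ‖v‖⁻¹ • v ∈ Metric.sphere (0 : ι → ℝ) 1 := by
        simp [norm_smul, norm_ne_zero_iff.2 hv]
      simp [he] at this
  · obtain ⟨w, hw, hmin⟩ := (isCompact_sphere (0 : ι → ℝ) 1).exists_isMinOn hne hcont.continuousOn
    have hw0 : 0 < N w := by
      refine (apply_nonneg N w).lt_of_ne fun h => ?_
      have := hN w h.symm
      simp [this] at hw
    refine ⟨(N w)⁻¹, inv_pos.2 hw0, fun v => ?_⟩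
    by_cases hv : v = 0
    · simp [hv]
    · have hv' : 0 < ‖v‖ := norm_pos_iff.2 hv
      have hs : ‖v‖⁻¹ • v ∈ Metric.sphere (0 : ι → ℝ) 1 := by
        simp [norm_smul, norm_ne_zero_iff.2 hv]
      have h1 : N w ≤ N (‖v‖⁻¹ • v) := hmin hs
      rw [map_smul_eq_mul, norm_inv, norm_norm, inv_mul_eq_div, le_div_iff₀ hv'] at h1
      rwa [inv_mul_eq_div, le_div_iff₀ hw0, mul_comm]

end Seminorm

/-! ### Limits superior as Landau relations -/

section Limsup

variable {g γ : ℝ → ℝ}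

theorem limsupRatio_nonneg (hγ : IsRate γ) (hg : ∀ t, 0 ≤ g t) : 0 ≤ limsupRatio g γ := by
  refine le_limsup_of_frequently_le' (Eventually.frequently ?_)
  filter_upwards [eventually_ge_atTop 0] with t ht
  exact_mod_cast div_nonneg (hg t) (hγ.pos t ht).le

theorem limsupRatio_le_of_eventually_le (hγ : IsRate γ) {c : ℝ}
    (h : ∀ᶠ t in atTop, g t ≤ c * γ t) : limsupRatio g γ ≤ c := by
  refine limsup_le_of_le (h := ?_)
  filter_upwards [eventually_ge_atTop 0, h] with t ht hle
  exact_mod_cast (div_le_iff₀ (hγ.pos t ht)).2 hle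

theorem eventually_le_of_limsupRatio_lt (hγ : IsRate γ) {c : ℝ} (h : limsupRatio g γ < c) :
    ∀ᶠ t in atTop, g t ≤ c * γ t := by
  filter_upwards [eventually_ge_atTop 0, eventually_lt_of_limsup_lt h] with t ht hlt
  exact (div_le_iff₀ (hγ.pos t ht)).1 (by exact_mod_cast hlt.le)

theorem limsupRatio_le_zero_iff (hγ : IsRate γ) (hg : ∀ t, 0 ≤ g t) :
    limsupRatio g γ ≤ 0 ↔ g =o[atTop] γ := by
  rw [hγ.isLittleO_iff]
  simp only [fun t => Real.norm_of_nonneg (hg t)]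
  refine ⟨fun h c hc => eventually_le_of_limsupRatio_lt hγ (h.trans_lt (by exact_mod_cast hc)),
    fun h => EReal.le_of_forall_lt_iff_le.1 fun c hc => ?_⟩
  exact limsupRatio_le_of_eventually_le hγ (h c (by exact_mod_cast hc))

theorem limsupRatio_pos_iff (hγ : IsRate γ) (hg : ∀ t, 0 ≤ g t) :
    0 < limsupRatio g γ ↔ ¬ g =o[atTop] γ := by
  rw [← limsupRatio_le_zero_iff hγ hg, not_le]

theorem limsupRatio_eq_zero_iff (hγ : IsRate γ) (hg : ∀ t, 0 ≤ g t) :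
    limsupRatio g γ = 0 ↔ g =o[atTop] γ := by
  rw [← limsupRatio_le_zero_iff hγ hg]
  exact ⟨le_of_eq, fun h => h.antisymm (limsupRatio_nonneg hγ hg)⟩

theorem limsupRatio_lt_top_iff (hγ : IsRate γ) (hg : ∀ t, 0 ≤ g t) :
    limsupRatio g γ < ⊤ ↔ g =O[atTop] γ := by
  rw [hγ.isBigO_iff]
  simp only [fun t => Real.norm_of_nonneg (hg t)]
  refine ⟨fun h => ?_, fun ⟨c, _, h⟩ =>
    (limsupRatio_le_of_eventually_le hγ h).trans_lt (EReal.coe_lt_top c)⟩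
  obtain ⟨c, hc, -⟩ := EReal.lt_iff_exists_real_btwn.1 h
  have hc0 : 0 < c := by exact_mod_cast (limsupRatio_nonneg hγ hg).trans_lt hc
  exact ⟨c, hc0, eventually_le_of_limsupRatio_lt hγ hc⟩

theorem limsupRatio_seminorm_mem_Ioo_iff {ι : Type*} [Fintype ι] (N : Seminorm ℝ (ι → ℝ))
    (hN : ∀ v, N v = 0 → v = 0) (hγ : IsRate γ) (u : ℝ → ι → ℝ) :
    limsupRatio (fun t => N (u t)) γ ∈ Ioo (0 : EReal) ⊤ ↔
      u =O[atTop] γ ∧ ¬ u =o[atTop] γ := by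
  obtain ⟨C, -, hC⟩ := N.exists_le_mul_norm
  obtain ⟨C', -, hC'⟩ := N.exists_norm_le_mul hN
  have h1 : (fun t => N (u t)) =O[atTop] u := IsBigO.of_bound C <| .of_forall fun t => by
    rw [Real.norm_of_nonneg (apply_nonneg N _)]
    exact hC _
  have h2 : u =O[atTop] (fun t => N (u t)) := IsBigO.of_bound C' <| .of_forall fun t => by
    rw [Real.norm_of_nonneg (apply_nonneg N _)]
    exact hC' _
  have hg : ∀ t, 0 ≤ N (u t) := fun t => apply_nonneg N _
  rw [mem_Ioo, limsupRatio_pos_iff hγ hg, limsupRatio_lt_top_iff hγ hg, and_comm]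
  exact and_congr ⟨h2.trans, h1.trans⟩ (not_congr ⟨h2.trans_isLittleO, h1.trans_isLittleO⟩)

end Limsup

/-! ### The primitive of the forcing and its increments -/

section Primitive

variable {d : ℕ} {F : ℝ → Fin d → ℝ} {γ : ℝ → ℝ}

/-- The primitive of `F` vanishing on `(-∞, 0]`. -/
noncomputable def halfPrimitive (F : ℝ → Fin d → ℝ) (t : ℝ) : Fin d → ℝ :=
  ∫ s in (0 : ℝ)..max t 0, F s

theorem halfPrimitive_of_nonpos {t : ℝ} (ht : t ≤ 0) : halfPrimitive F t = 0 := by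
  simp [halfPrimitive, ht]

theorem intervalIntegrable_of_continuousOn_Ici (hF : ContinuousOn F (Ici 0)) {a b : ℝ}
    (ha : 0 ≤ a) (hb : 0 ≤ b) : IntervalIntegrable F volume a b :=
  (hF.mono fun _ hs => (le_min ha hb).trans hs.1).intervalIntegrable

theorem integral_eq_halfPrimitive_sub (hF : ContinuousOn F (Ici 0)) {a b : ℝ}
    (ha : 0 ≤ a) (hb : 0 ≤ b) : ∫ s in a..b, F s = halfPrimitive F b - halfPrimitive F a := by
  rw [halfPrimitive, halfPrimitive, max_eq_left ha, max_eq_left hb,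
    intervalIntegral.integral_interval_sub_left
      (intervalIntegrable_of_continuousOn_Ici hF le_rfl hb)
      (intervalIntegrable_of_continuousOn_Ici hF le_rfl ha)]

theorem integral_lag_eq (hF : ContinuousOn F (Ici 0)) {t θ : ℝ} (ht : 0 ≤ t) :
    ∫ s in (max (t - θ) 0)..t, F s = halfPrimitive F t - halfPrimitive F (t - θ) := by
  rw [integral_eq_halfPrimitive_sub hF (le_max_right _ _) ht]
  simp [halfPrimitive]

theorem halfPrimitive_eq_integral (t : ℝ) :
    halfPrimitive F t = ∫ s in (0 : ℝ)..max t 0, F (max s 0) := by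
  refine intervalIntegral.integral_congr fun s hs => ?_
  rw [uIcc_of_le (le_max_right _ _)] at hs
  simp [hs.1]

theorem continuous_comp_max (hF : ContinuousOn F (Ici 0)) : Continuous fun s => F (max s 0) :=
  hF.comp_continuous (by fun_prop) fun s => le_max_right s 0

theorem continuous_halfPrimitive (hF : ContinuousOn F (Ici 0)) :
    Continuous (halfPrimitive F) := by
  rw [funext halfPrimitive_eq_integral]
  exact (intervalIntegral.continuous_primitive
    (fun a b => (continuous_comp_max hF).intervalIntegrable a b) 0).comp (by fun_prop)

theorem hasDerivWithinAt_halfPrimitive (hF : ContinuousOn F (Ici 0)) {t : ℝ} (ht : 0 ≤ t) :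
    HasDerivWithinAt (halfPrimitive F) (F t) (Ici 0) t := by
  have h := ((continuous_comp_max hF).integral_hasStrictDerivAt 0 t).hasDerivAt.hasDerivWithinAt
    (s := Ici 0)
  rw [max_eq_left ht] at h
  refine h.congr (fun s hs => ?_) ?_
  · rw [halfPrimitive_eq_integral, max_eq_left hs]
  · rw [halfPrimitive_eq_integral, max_eq_left ht]

theorem lagLimsup_isLittleO_iff (hF : ContinuousOn F (Ici 0)) (i : Fin d) {θ : ℝ} (hθ : 0 ≤ θ) :
    (fun t : ℝ => |∫ s in (t - θ)..t, F s i|) =o[atTop] γ ↔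
      (fun t : ℝ => halfPrimitive F t i - halfPrimitive F (t - θ) i) =o[atTop] γ := by
  rw [← isLittleO_norm_left (f' := fun t : ℝ => halfPrimitive F t i - _)]
  refine isLittleO_congr ((eventually_ge_atTop θ).mono fun t ht => ?_) .rfl
  have h1 : 0 ≤ t - θ := sub_nonneg.2 ht
  have h2 : 0 ≤ t := hθ.trans ht
  have h3 := (ContinuousLinearMap.proj (R := ℝ) (φ := fun _ : Fin d => ℝ) i).intervalIntegral_comp_comm
    (intervalIntegrable_of_continuousOn_Ici hF h1 h2)
  rw [integral_eq_halfPrimitive_sub hF h1 h2] at h3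
  simp only [ContinuousLinearMap.proj_apply, Pi.sub_apply] at h3
  simp only [h3, Real.norm_eq_abs]

theorem lagLimsup_pos_iff (hγ : IsRate γ) (hF : ContinuousOn F (Ici 0)) (i : Fin d) {θ : ℝ}
    (hθ : 0 ≤ θ) : 0 < lagLimsup (fun s => F s i) γ θ ↔
      ¬ (fun t : ℝ => halfPrimitive F t i - halfPrimitive F (t - θ) i) =o[atTop] γ := by
  rw [← lagLimsup_isLittleO_iff hF i hθ]
  exact limsupRatio_pos_iff hγ fun t => abs_nonneg _

theorem lagLimsup_eq_zero_iff (hγ : IsRate γ) (hF : ContinuousOn F (Ici 0)) (i : Fin d) {θ : ℝ}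
    (hθ : 0 ≤ θ) : lagLimsup (fun s => F s i) γ θ = 0 ↔
      (fun t : ℝ => halfPrimitive F t i - halfPrimitive F (t - θ) i) =o[atTop] γ := by
  rw [← lagLimsup_isLittleO_iff hF i hθ]
  exact limsupRatio_eq_zero_iff hγ fun t => abs_nonneg _

/-- Increments of `J` over lags in `[0, Δ]` are bounded by `K γ`. -/
def LagBounded (J : ℝ → Fin d → ℝ) (γ : ℝ → ℝ) (Δ : ℝ) : Prop :=
  ∃ K : ℝ, 0 < K ∧ ∀ θ ∈ Icc (0 : ℝ) Δ, ∀ t : ℝ, 0 ≤ t → ‖J t - J (t - θ)‖ ≤ K * γ t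

theorem exists_lagIntegralBound_iff (N : Seminorm ℝ (Fin d → ℝ)) (hN : ∀ v, N v = 0 → v = 0)
    (hF : ContinuousOn F (Ici 0)) (Δ : ℝ) :
    (∃ K : ℝ, 0 < K ∧ LagIntegralBound N F γ Δ K) ↔ LagBounded (halfPrimitive F) γ Δ := by
  obtain ⟨C, hC0, hC⟩ := N.exists_le_mul_norm
  obtain ⟨C', hC0', hC'⟩ := N.exists_norm_le_mul hN
  constructor
  · rintro ⟨K, hK, h⟩
    refine ⟨C' * K, mul_pos hC0' hK, fun θ hθ t ht => ?_⟩
    have := h θ hθ t ht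
    rw [integral_lag_eq hF ht] at this
    rw [mul_assoc]
    exact (hC' _).trans (mul_le_mul_of_nonneg_left this hC0'.le)
  · rintro ⟨K, hK, h⟩
    refine ⟨C * K, mul_pos hC0 hK, fun θ hθ t ht => ?_⟩
    rw [integral_lag_eq hF ht, mul_assoc]
    exact (hC _).trans (mul_le_mul_of_nonneg_left (h θ hθ t ht) hC0.le)

/-- A long lag is a sum of lags of length at most `Δ`; each is bounded at an earlier time, where `γ`
is no larger. -/
theorem LagBounded.of_pos (hγ : IsRate γ) {J : ℝ → Fin d → ℝ} (hJ : ∀ t ≤ 0, J t = 0) {Δ : ℝ}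
    (hΔ : 0 < Δ) (h : LagBounded J γ Δ) (Δ' : ℝ) : LagBounded J γ Δ' := by
  obtain ⟨K, hK, hb⟩ := h
  have key : ∀ n : ℕ, ∀ θ ∈ Icc (0 : ℝ) (n * Δ), ∀ t : ℝ, 0 ≤ t →
      ‖J t - J (t - θ)‖ ≤ n * K * γ t := by
    intro n
    induction n with
    | zero =>
      intro θ hθ t _
      have : θ = 0 := le_antisymm (by simpa using hθ.2) hθ.1
      simp [this]
    | succ n ih =>
      intro θ hθ t ht
      have h1 := hb (min θ Δ) ⟨le_min hθ.1 hΔ.le, min_le_right _ _⟩ t ht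
      have h2 : ‖J (t - min θ Δ) - J (t - θ)‖ ≤ n * K * γ t := by
        rcases le_total 0 (t - min θ Δ) with h0 | h0
        · have hle : t - min θ Δ ≤ t := sub_le_self _ (le_min hθ.1 hΔ.le)
          have h3 := ih (θ - min θ Δ) ⟨sub_nonneg.2 (min_le_left _ _), by
            have := hθ.2
            push_cast at this
            rcases min_choice θ Δ with h | h <;> rw [h] <;> nlinarith [n.cast_nonneg (α := ℝ)]⟩ _ h0
          rw [show t - min θ Δ - (θ - min θ Δ) = t - θ by ring] at h3
          exact h3.trans (mul_le_mul_of_nonneg_left (hγ.mono h0 ht hle) (by positivity))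
        -- Here both times are nonpositive, where `J` vanishes.
        · have h4 : t - θ ≤ 0 := (sub_le_sub_left (min_le_left _ _) _).trans h0
          rw [hJ _ h0, hJ _ h4, sub_zero, norm_zero]
          exact mul_nonneg (by positivity) (hγ.pos t ht).le
      have h3 := norm_add_le (J t - J (t - min θ Δ)) (J (t - min θ Δ) - J (t - θ))
      rw [sub_add_sub_cancel] at h3
      push_cast
      linarith
  obtain ⟨n, hn⟩ := exists_nat_ge (Δ' / Δ)
  rw [div_le_iff₀ hΔ] at hn
  -- `n + 1` keeps the constant positive even if `n = 0`.
  refine ⟨(n + 1 : ℕ) * K, by positivity, fun θ hθ t ht => key _ θ ⟨hθ.1, hθ.2.trans ?_⟩ t ht⟩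
  push_cast
  linarith

end Primitive

/-! ### Negligible lags and Steinhaus' theorem -/

section NegligibleLags

variable {j γ : ℝ → ℝ}

theorem IsRate.isLittleO_comp_sub {V : Type*} [NormedAddCommGroup V] (hγ : IsRate γ) {h : ℝ → V}
    (hh : h =o[atTop] γ) {c : ℝ} (hc : 0 ≤ c) : (fun t => h (t - c)) =o[atTop] γ := by
  have h1 := hh.comp_tendsto (tendsto_atTop_add_const_right atTop (-c) tendsto_id)
  refine h1.trans_isBigO (IsBigO.of_bound 1 ((eventually_ge_atTop c).mono fun t ht => ?_))
  have h2 : 0 ≤ t + -c := by linarith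
  have h3 : 0 ≤ t := hc.trans ht
  simp only [Function.comp_apply, id_eq]
  rw [hγ.norm_eq h2, hγ.norm_eq h3, one_mul]
  exact hγ.mono h2 h3 (by linarith)

/-- Increments of `j` over the lag `θ` are `o(γ)`. -/
def IsNegligibleLag (j γ : ℝ → ℝ) (θ : ℝ) : Prop :=
  (fun t => j t - j (t - θ)) =o[atTop] γ

theorem IsNegligibleLag.add (hγ : IsRate γ) {a b : ℝ} (ha0 : 0 ≤ a) (ha : IsNegligibleLag j γ a)
    (hb : IsNegligibleLag j γ b) : IsNegligibleLag j γ (a + b) := by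
  refine (IsLittleO.add ha (hγ.isLittleO_comp_sub hb ha0)).congr_left fun t => ?_
  rw [sub_add_sub_cancel, sub_sub]

theorem IsNegligibleLag.sub (hγ : IsRate γ) {a b : ℝ} (hab : a ≤ b) (ha : IsNegligibleLag j γ a)
    (hb : IsNegligibleLag j γ b) : IsNegligibleLag j γ (b - a) := by
  refine (IsLittleO.sub hb (hγ.isLittleO_comp_sub ha (sub_nonneg.2 hab))).congr_left fun t => ?_
  rw [show t - (b - a) - a = t - b by ring]
  ring

theorem IsNegligibleLag.nat_mul (hγ : IsRate γ) {a : ℝ} (ha0 : 0 ≤ a) (ha : IsNegligibleLag j γ a)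
    (n : ℕ) : IsNegligibleLag j γ (n * a) := by
  induction n with
  | zero => simp [IsNegligibleLag]
  | succ n ih =>
    have := ha.add hγ ha0 ih
    rwa [show ((n + 1 : ℕ) : ℝ) * a = a + n * a by push_cast; ring]

theorem measurableSet_isNegligibleLag (hγ : IsRate γ) (hj : Continuous j) :
    MeasurableSet {θ | IsNegligibleLag j γ θ} := by
  -- Countably many tolerances and starting times suffice; for each pair, continuity of `j` makes
  -- the condition closed in `θ`.
  have : {θ | IsNegligibleLag j γ θ} =
      ⋂ n : ℕ, ⋃ m : ℕ, {θ | ∀ t ≥ (m : ℝ), |j t - j (t - θ)| ≤ 1 / ((n : ℝ) + 1) * γ t} := by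
    ext θ
    simp only [mem_ofPred_eq, mem_iInter, mem_iUnion, IsNegligibleLag]
    rw [hγ.isLittleO_iff]
    constructor
    · intro h n
      obtain ⟨a, ha⟩ := eventually_atTop.1 (h (1 / ((n : ℝ) + 1)) (by positivity))
      obtain ⟨m, hm⟩ := exists_nat_ge a
      exact ⟨m, fun t ht => ha t (hm.trans ht)⟩
    · intro h c hc
      obtain ⟨n, hn⟩ := exists_nat_one_div_lt hc
      obtain ⟨m, hm⟩ := h n
      filter_upwards [eventually_ge_atTop (m : ℝ), eventually_ge_atTop 0] with t ht ht0
      exact (hm t ht).trans (mul_le_mul_of_nonneg_right hn.le (hγ.pos t ht0).le)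
  rw [this]
  refine .iInter fun n => .iUnion fun m => IsClosed.measurableSet ?_
  simp only [ofPred_forall]
  exact isClosed_iInter fun t => isClosed_iInter fun _ =>
    isClosed_le (by fun_prop) continuous_const

/-- If the negligible lags in `[0, Δ]` are not a null set, then every lag is negligible. -/
theorem IsNegligibleLag.of_volume_ne_zero (hγ : IsRate γ) (hj : Continuous j) {Δ : ℝ}
    (h : volume {θ | θ ∈ Icc 0 Δ ∧ IsNegligibleLag j γ θ} ≠ 0) {θ : ℝ} (hθ : 0 ≤ θ) :
    IsNegligibleLag j γ θ := by
  -- Steinhaus: the difference set contains a neighbourhood of `0`, so all short lags are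
  -- negligible; any lag is a multiple of a short one.
  have hS := Measure.sub_mem_nhds_zero_of_addHaar_pos volume
    {θ | θ ∈ Icc 0 Δ ∧ IsNegligibleLag j γ θ}
    (measurableSet_Icc.inter (measurableSet_isNegligibleLag hγ hj)) (pos_iff_ne_zero.2 h)
  obtain ⟨δ, hδ, hball⟩ := Metric.mem_nhds_iff.1 hS
  have hsmall : ∀ φ, 0 ≤ φ → φ < δ → IsNegligibleLag j γ φ := by
    intro φ h0 hlt
    obtain ⟨b, hb, a, ha, hab⟩ := hball (show φ ∈ Metric.ball 0 δ by simpa [abs_of_nonneg h0])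
    rw [← show b - a = φ from hab]
    exact ha.2.sub hγ (sub_nonneg.1 (h0.trans_eq hab.symm)) hb.2
  obtain ⟨n, hn⟩ := exists_nat_gt (θ / δ)
  have hn0 : (0 : ℝ) < n := (div_nonneg hθ hδ.le).trans_lt hn
  rw [div_lt_iff₀ hδ] at hn
  have := (hsmall (θ / n) (by positivity) ((div_lt_iff₀ hn0).2 (by linarith))).nat_mul hγ
    (by positivity) n
  rwa [mul_div_cancel₀ _ hn0.ne'] at this

end NegligibleLags

/-! ### Increments of the primitive against the solution `y` -/

section LagsAndSolution

variable {d : ℕ} {F y : ℝ → Fin d → ℝ} {γ : ℝ → ℝ}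

theorem IsForcedSolution.continuousOn {A : Matrix (Fin d) (Fin d) ℝ} {ξ : Fin d → ℝ}
    (hy : IsForcedSolution A F ξ y) : ContinuousOn y (Ici 0) :=
  fun t ht => (hy.2 t ht).continuousWithinAt

theorem exists_forall_norm_le_of_isBigO (hγ : IsRate γ) (hy : ContinuousOn y (Ici 0))
    (h : y =O[atTop] γ) : ∃ M > 0, ∀ t, 0 ≤ t → ‖y t‖ ≤ M * γ t := by
  obtain ⟨c, hc, hb⟩ := hγ.isBigO_iff.1 h
  obtain ⟨T, hT⟩ := eventually_atTop.1 hb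
  obtain ⟨C, hC⟩ := (isCompact_Icc (a := (0 : ℝ)) (b := T)).exists_bound_of_continuousOn
    (hy.mono Icc_subset_Ici_self)
  have h0 := hγ.pos 0 le_rfl
  -- `c` works beyond `T`; on `[0, T]` compactness and `γ 0 ≤ γ t` give the other summand.
  refine ⟨c + |C| / γ 0, by positivity, fun t ht => ?_⟩
  have hpos := hγ.pos t ht
  have hle : γ 0 ≤ γ t := hγ.mono self_mem_Ici ht ht
  have hq : 0 ≤ |C| / γ 0 := by positivity
  rcases le_total T t with h1 | h1
  · nlinarith [hT t h1]
  · have h2 : |C| ≤ |C| / γ 0 * γ t := by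
      rw [div_mul_eq_mul_div, le_div_iff₀ h0]
      exact mul_le_mul_of_nonneg_left hle (abs_nonneg _)
    nlinarith [hC t ⟨ht, h1⟩, le_abs_self C]

/-- `J - y` has derivative `y`, contributing `(b - a) * M`; the endpoint values of `y` contribute `2
* M`. -/
theorem norm_halfPrimitive_sub_le (hF : ContinuousOn F (Ici 0))
    (hy : IsForcedSolution (-1) F 0 y) {a b M : ℝ} (ha : 0 ≤ a) (hab : a ≤ b)
    (hM : ∀ t ∈ Icc a b, ‖y t‖ ≤ M) :
    ‖halfPrimitive F b - halfPrimitive F a‖ ≤ (2 + (b - a)) * M := by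
  have hd : ∀ t, 0 ≤ t → HasDerivWithinAt (fun t => halfPrimitive F t - y t) (y t) (Ici 0) t :=
    fun t ht => by
      refine ((hasDerivWithinAt_halfPrimitive hF ht).sub (hy.2 t ht)).congr_deriv ?_
      simp [Matrix.neg_mulVec]
  have h1 := norm_image_sub_le_of_norm_deriv_right_le_segment (a := a) (b := b)
    (fun t ht => (hd t (ha.trans ht.1)).continuousWithinAt.mono fun s hs => ha.trans hs.1)
    (fun t ht => (hd t (ha.trans ht.1)).mono (Ici_subset_Ici.2 (ha.trans ht.1)))
    (fun t ht => hM t ⟨ht.1, ht.2.le⟩) b (right_mem_Icc.2 hab)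
  have h2 := hM a (left_mem_Icc.2 hab)
  have h3 := hM b (right_mem_Icc.2 hab)
  have h4 : halfPrimitive F b - halfPrimitive F a =
      (halfPrimitive F b - y b - (halfPrimitive F a - y a)) + (y b - y a) := by abel
  rw [h4]
  calc _ ≤ _ := norm_add_le _ _
    _ ≤ M * (b - a) + (‖y b‖ + ‖y a‖) := add_le_add h1 (norm_sub_le _ _)
    _ ≤ _ := by linarith

theorem lagBounded_of_isBigO (hγ : IsRate γ) (hF : ContinuousOn F (Ici 0))
    (hy : IsForcedSolution (-1) F 0 y) (h : y =O[atTop] γ) {Δ : ℝ} (hΔ : 0 < Δ) :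
    LagBounded (halfPrimitive F) γ Δ := by
  obtain ⟨M, hM, hb⟩ := exists_forall_norm_le_of_isBigO hγ hy.continuousOn h
  refine ⟨(2 + Δ) * M, by positivity, fun θ hθ t ht => ?_⟩
  have h1 : halfPrimitive F (t - θ) = halfPrimitive F (max (t - θ) 0) := by simp [halfPrimitive]
  have h2 : max (t - θ) 0 ≤ t := max_le (sub_le_self _ hθ.1) ht
  have h3 : t - max (t - θ) 0 ≤ Δ := by linarith [le_max_left (t - θ) 0, hθ.2]
  have h4 := hγ.pos t ht
  rw [h1]
  refine (norm_halfPrimitive_sub_le hF hy (le_max_right _ _) h2 (M := M * γ t) fun s hs => ?_).trans ?_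
  · have hs0 : 0 ≤ s := (le_max_right _ _).trans hs.1
    exact (hb s hs0).trans (mul_le_mul_of_nonneg_left (hγ.mono hs0 ht hs.2) hM.le)
  · rw [mul_assoc]
    exact mul_le_mul_of_nonneg_right (by linarith) (by positivity)

theorem isLittleO_lag_of_isLittleO (hγ : IsRate γ) (hF : ContinuousOn F (Ici 0))
    (hy : IsForcedSolution (-1) F 0 y) (h : y =o[atTop] γ) {θ : ℝ} (hθ : 0 ≤ θ) :
    (fun t => halfPrimitive F t - halfPrimitive F (t - θ)) =o[atTop] γ := by
  refine hγ.isLittleO_iff.2 fun c hc => ?_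
  have hc' : 0 < c / (2 + θ) := by positivity
  obtain ⟨T, hT⟩ := eventually_atTop.1 (hγ.isLittleO_iff.1 h _ hc')
  filter_upwards [eventually_ge_atTop (max T 0 + θ)] with t ht
  have h1 : max T 0 ≤ t - θ := by linarith
  have h0 : 0 ≤ t - θ := (le_max_right _ _).trans h1
  have := norm_halfPrimitive_sub_le hF hy h0 (sub_le_self t hθ) (M := c / (2 + θ) * γ t)
    fun s hs => (hT s ((le_max_left _ _).trans (h1.trans hs.1))).trans <|
      mul_le_mul_of_nonneg_left (hγ.mono (h0.trans hs.1) (by simp; linarith) hs.2) hc'.le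
  refine this.trans_eq ?_
  rw [sub_sub_cancel]
  field_simp

theorem IsRate.isLittleO_iff_tendsto {V : Type*} [NormedAddCommGroup V] [NormedSpace ℝ V]
    (hγ : IsRate γ) {h : ℝ → V} :
    h =o[atTop] γ ↔ Tendsto (fun t => (γ t)⁻¹ • h t) atTop (𝓝 0) := by
  rw [hγ.isLittleO_iff, Metric.nhds_basis_closedBall.tendsto_right_iff]
  refine forall₂_congr fun c hc => eventually_congr ((eventually_ge_atTop 0).mono fun t ht => ?_)
  have := hγ.pos t ht
  rw [mem_closedBall_zero_iff, norm_smul, norm_inv, hγ.norm_eq ht, inv_mul_le_iff₀ this, mul_comm]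

/-- The average of the increments of `J` over lags in `[0, 1]`. -/
noncomputable def meanLag (J : ℝ → Fin d → ℝ) (t : ℝ) : Fin d → ℝ :=
  ∫ u in (0 : ℝ)..1, (J t - J (t - u))

theorem meanLag_eq {J : ℝ → Fin d → ℝ} (hJ : Continuous J) (t : ℝ) :
    meanLag J t = J t - ((∫ s in (0 : ℝ)..t, J s) - ∫ s in (0 : ℝ)..(t - 1), J s) := by
  have hi : ∀ a b, IntervalIntegrable J volume a b := fun a b => hJ.intervalIntegrable a b
  rw [meanLag, intervalIntegral.integral_sub (by simp)
    (Continuous.intervalIntegrable (by fun_prop) _ _),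
    intervalIntegral.integral_comp_sub_left (fun s => J s),
    intervalIntegral.integral_interval_sub_left (hi _ _) (hi _ _)]
  simp

theorem hasDerivWithinAt_meanLag (hF : ContinuousOn F (Ici 0)) {t : ℝ} (ht : 0 ≤ t) :
    HasDerivWithinAt (meanLag (halfPrimitive F))
      (F t - (halfPrimitive F t - halfPrimitive F (t - 1))) (Ici 0) t := by
  have hJ := continuous_halfPrimitive hF
  rw [funext (meanLag_eq hJ)]
  have h1 : ∀ s, HasDerivAt (fun t => ∫ s in (0 : ℝ)..t, halfPrimitive F s) (halfPrimitive F s) s :=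
    fun s => (hJ.integral_hasStrictDerivAt 0 s).hasDerivAt
  exact (hasDerivWithinAt_halfPrimitive hF ht).sub
    ((h1 t).sub ((h1 (t - 1)).comp_sub_const t 1)).hasDerivWithinAt

/-- The `o` case is dominated convergence over `u ∈ [0, 1]` with constant majorant `K`, so smallness
for each fixed lag suffices, without uniformity. -/
theorem dominated_meanLag {o : Prop} (hγ : IsRate γ) {J : ℝ → Fin d → ℝ} (hJ : Continuous J)
    (hb : LagBounded J γ 1) (ho : o → ∀ θ, 0 ≤ θ → (fun t => J t - J (t - θ)) =o[atTop] γ) :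
    Dominated o (meanLag J) γ := by
  obtain ⟨K, hK, hb⟩ := hb
  have hmem : ∀ {u : ℝ}, u ∈ uIoc (0 : ℝ) 1 → u ∈ Icc (0 : ℝ) 1 := fun hu => by
    rw [uIoc_of_le zero_le_one] at hu
    exact ⟨hu.1.le, hu.2⟩
  refine ⟨hγ.isBigO_iff.2 ⟨K, hK, (eventually_ge_atTop 0).mono fun t ht => ?_⟩, fun h => ?_⟩
  · simpa [meanLag] using intervalIntegral.norm_integral_le_of_norm_le_const fun u hu => hb u (hmem hu) t ht
  · rw [hγ.isLittleO_iff_tendsto]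
    simp only [meanLag, ← intervalIntegral.integral_smul]
    rw [← intervalIntegral.integral_zero (E := Fin d → ℝ) (μ := volume) (a := 0) (b := 1)]
    refine intervalIntegral.tendsto_integral_filter_of_dominated_convergence (fun _ => K)
      (.of_forall fun t => Continuous.aestronglyMeasurable (by fun_prop)) ?_ (by simp) ?_
    · filter_upwards [eventually_ge_atTop 0] with t ht
      refine .of_forall fun u hu => ?_
      have := hγ.pos t ht
      rw [norm_smul, norm_inv, hγ.norm_eq ht, inv_mul_le_iff₀ this, mul_comm]
      exact hb u (hmem hu) t ht
    · exact .of_forall fun u hu => hγ.isLittleO_iff_tendsto.1 (ho h u (hmem hu).1)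

theorem dominated_of_lags {o : Prop} (hγ : IsRate γ) (hF : ContinuousOn F (Ici 0))
    (hy : IsForcedSolution (-1) F 0 y) (hb : LagBounded (halfPrimitive F) γ 1)
    (ho : o → ∀ θ, 0 ≤ θ →
      (fun t => halfPrimitive F t - halfPrimitive F (t - θ)) =o[atTop] γ) :
    Dominated o y γ := by
  have hv := dominated_meanLag hγ (continuous_halfPrimitive hF) hb ho
  have hlag : Dominated o (fun t => halfPrimitive F t - halfPrimitive F (t - 1)) γ := by
    refine ⟨?_, fun h => ho h 1 zero_le_one⟩
    obtain ⟨K, hK, hb⟩ := hb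
    exact hγ.isBigO_iff.2 ⟨K, hK, (eventually_ge_atTop 0).mono fun t ht =>
      hb 1 ⟨zero_le_one, le_rfl⟩ t ht⟩
  -- `F` cancels: the difference `z` solves `z' = -z + (J t - J (t - 1)) - meanLag J t`, where `J =
  -- halfPrimitive F`.
  have key : Dominated o (fun t => y t - meanLag (halfPrimitive F) t) γ := by
    refine Dominated.of_hurwitz hγ isHurwitz_neg_one (fun t ht => ?_) (hlag.add hv.neg)
    refine ((hy.2 t ht).sub (hasDerivWithinAt_meanLag hF ht)).congr_deriv ?_
    simp only [Matrix.neg_mulVec, Matrix.one_mulVec]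
    abel
  simpa using key.add hv

end LagsAndSolution

/-! ### Orders of `y` in terms of lags -/

section Equivalences

variable {d : ℕ} {F y : ℝ → Fin d → ℝ} {γ : ℝ → ℝ}

theorem isLittleO_lag_iff {J : ℝ → Fin d → ℝ} {θ : ℝ} :
    (fun t => J t - J (t - θ)) =o[atTop] γ ↔ ∀ i, IsNegligibleLag (fun t => J t i) γ θ :=
  isLittleO_pi

theorem isBigO_iff_lagBounded (hγ : IsRate γ) (hF : ContinuousOn F (Ici 0))
    (hy : IsForcedSolution (-1) F 0 y) :
    y =O[atTop] γ ↔ LagBounded (halfPrimitive F) γ 1 :=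
  ⟨fun h => lagBounded_of_isBigO hγ hF hy h one_pos,
    fun h => (dominated_of_lags (o := False) hγ hF hy h False.elim).1⟩

theorem isLittleO_iff_forall_isNegligibleLag (hγ : IsRate γ) (hF : ContinuousOn F (Ici 0))
    (hy : IsForcedSolution (-1) F 0 y) (hb : LagBounded (halfPrimitive F) γ 1) :
    y =o[atTop] γ ↔
      ∀ i, ∀ θ, 0 ≤ θ → IsNegligibleLag (fun t => halfPrimitive F t i) γ θ :=
  ⟨fun h i _ hθ => isLittleO_lag_iff.1 (isLittleO_lag_of_isLittleO hγ hF hy h hθ) i,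
    fun h => (dominated_of_lags (o := True) hγ hF hy hb fun _ θ hθ =>
      isLittleO_lag_iff.2 fun i => h i θ hθ).2 trivial⟩

end Equivalences

/-! ### The equivalences -/

theorem mainTheorem8 (d : ℕ) (A : Matrix (Fin d) (Fin d) ℝ) (hA : IsHurwitz A)
    (N : Seminorm ℝ (Fin d → ℝ)) (hN : ∀ v : Fin d → ℝ, N v = 0 → v = 0)
    (F : ℝ → Fin d → ℝ) (hF : ContinuousOn F (Ici 0))
    (γ : ℝ → ℝ) (hγ_cont : ContinuousOn γ (Ici 0)) (hγ_mono : MonotoneOn γ (Ici 0))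
    (hγ_pos : ∀ t : ℝ, 0 ≤ t → 0 < γ t)
    (ζ : Fin d → ℝ) (x : ℝ → Fin d → ℝ) (hx : IsForcedSolution A F ζ x)
    (y : ℝ → Fin d → ℝ) (hy : IsForcedSolution (-1) F 0 y) :
    List.TFAE [
      -- (A)
      (∃ Δ : ℝ, 0 < Δ ∧ ∃ K : ℝ, 0 < K ∧ LagIntegralBound N F γ Δ K) ∧
        (∃ i : Fin d, ∃ θ' : ℝ, 0 < θ' ∧ 0 < lagLimsup (fun s => F s i) γ θ'),
      -- (A')
      ∀ Δ : ℝ, 0 < Δ →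
        (∃ K : ℝ, 0 < K ∧ LagIntegralBound N F γ Δ K) ∧
        (∃ i : Fin d, ∃ θ' ∈ Ioc (0 : ℝ) Δ, 0 < lagLimsup (fun s => F s i) γ θ'),
      -- (A'')
      ∀ Δ : ℝ, 0 < Δ →
        (∃ K : ℝ, 0 < K ∧ LagIntegralBound N F γ Δ K) ∧
        (∃ i : Fin d,
          volume {θ : ℝ | θ ∈ Icc (0 : ℝ) Δ ∧ lagLimsup (fun s => F s i) γ θ = 0} = 0),
      -- (B)
      limsupRatio (fun t => N (y t)) γ ∈ Ioo (0 : EReal) ⊤,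
      -- (C)
      limsupRatio (fun t => N (x t)) γ ∈ Ioo (0 : EReal) ⊤] := by
  have hγ : IsRate γ := ⟨hγ_mono, hγ_pos⟩
  have hJ0 : ∀ t ≤ 0, halfPrimitive F t = 0 := fun _ => halfPrimitive_of_nonpos
  have hJi : ∀ i, Continuous fun t => halfPrimitive F t i := fun i =>
    (continuous_apply i).comp (continuous_halfPrimitive hF)
  have hpos : ∀ i θ, 0 ≤ θ → (0 < lagLimsup (fun s => F s i) γ θ ↔
      ¬ IsNegligibleLag (fun t => halfPrimitive F t i) γ θ) :=
    fun i θ hθ => lagLimsup_pos_iff hγ hF i hθ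
  have hset : ∀ i Δ, {θ : ℝ | θ ∈ Icc (0 : ℝ) Δ ∧ lagLimsup (fun s => F s i) γ θ = 0} =
      {θ : ℝ | θ ∈ Icc (0 : ℝ) Δ ∧ IsNegligibleLag (fun t => halfPrimitive F t i) γ θ} :=
    fun i Δ => Set.ext fun θ => and_congr_right fun hθ => lagLimsup_eq_zero_iff hγ hF i hθ.1
  simp only [exists_lagIntegralBound_iff N hN hF, limsupRatio_seminorm_mem_Ioo_iff N hN hγ, hset]
  tfae_have 1 → 3 := by
    rintro ⟨⟨Δ₀, hΔ₀, hb⟩, i, θ, hθ, hlim⟩ Δ hΔ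
    refine ⟨hb.of_pos hγ hJ0 hΔ₀ Δ, i, ?_⟩
    by_contra hvol
    exact (hpos i θ hθ.le).1 hlim (.of_volume_ne_zero hγ (hJi i) hvol hθ.le)
  tfae_have 3 → 2 := by
    intro h Δ hΔ
    obtain ⟨hb, i, hvol⟩ := h Δ hΔ
    refine ⟨hb, i, ?_⟩
    by_contra! hcon
    -- Otherwise all of `(0, Δ]`, of measure `Δ > 0`, would lie in a null set.
    have hsub : Ioc 0 Δ ⊆
        {θ | θ ∈ Icc 0 Δ ∧ IsNegligibleLag (fun t => halfPrimitive F t i) γ θ} := fun θ hθ =>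
      ⟨Ioc_subset_Icc_self hθ, not_not.1 fun hn =>
        (hcon θ hθ).not_gt ((hpos i θ hθ.1.le).2 hn)⟩
    have := measure_mono_null hsub hvol
    rw [Real.volume_Ioc, sub_zero, ENNReal.ofReal_eq_zero] at this
    exact this.not_gt hΔ
  tfae_have 2 → 4 := by
    intro h
    obtain ⟨hb, i, θ, hθ, hlim⟩ := h 1 one_pos
    refine ⟨(isBigO_iff_lagBounded hγ hF hy).2 hb, fun ho => ?_⟩
    exact (hpos i θ hθ.1.le).1 hlim
      ((isLittleO_iff_forall_isNegligibleLag hγ hF hy hb).1 ho i θ hθ.1.le)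
  tfae_have 4 → 1 := by
    rintro ⟨hO, ho⟩
    have hb := (isBigO_iff_lagBounded hγ hF hy).1 hO
    refine ⟨⟨1, one_pos, hb⟩, ?_⟩
    rw [isLittleO_iff_forall_isNegligibleLag hγ hF hy hb] at ho
    push Not at ho
    obtain ⟨i, θ, hθ, hn⟩ := ho
    refine ⟨i, θ, hθ.lt_of_ne ?_, (hpos i θ hθ).2 hn⟩
    -- The zero lag is trivially negligible, so `θ` is strictly positive.
    rintro rfl
    simp [IsNegligibleLag] at hn
  have hxy : ∀ o, Dominated o x γ ↔ Dominated o y γ := fun o =>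
    ⟨Dominated.forced_of_forced hγ isHurwitz_neg_one hx hy, Dominated.forced_of_forced hγ hA hy hx⟩
  have hO : x =O[atTop] γ ↔ y =O[atTop] γ := by simpa [Dominated] using hxy False
  have ho : x =o[atTop] γ ↔ y =o[atTop] γ := by
    have h : ∀ u : ℝ → Fin d → ℝ, Dominated True u γ ↔ u =o[atTop] γ := fun u =>
      ⟨fun h => h.2 trivial, fun h => ⟨h.isBigO, fun _ => h⟩⟩
    rw [← h, ← h, hxy]
  tfae_have 4 ↔ 5 := by rw [hO, ho]
  tfae_finish
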